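/- A quantum Latin square $\mathrm{QLS}(v)$ is a $v\times v$ array $\Phi=(|\Phi_{ij}\rangle)$ of vectors of $\mathbb{C}^v$ such that every row and every column is an orthonormal basis of $\mathbb{C}^v$. It is idempotent if its diagonal entries $|\Phi_{ii}\rangle$ also form an orthonormal basis of $\mathbb{C}^v$. Two such squares $\Phi,\Psi$ are equivalent if there are a unitary operator $U$ on $\mathbb{C}^v$, complex numbers $c_{ij}$ of modulus $1$ and permutations $\sigma,\tau\in S_v$ such that $|\Psi_{ij}\rangle=c_{ij}\,U|\Phi_{\sigma(i),\tau(j)}\rangle$ for all $i,j$. A $\mathrm{QLS}(v)$ is classical if it is equivalent to one of the form $(|L_{ij}\rangle)$, where $L$ is a Latin square of order $v$ and $\{|0\rangle,\dots,|v-1\rangle\}$ is the standard basis of $\mathbb{C}^v$; otherwise it is non-classical. Theorem. For $v\in\{3,4,5\}$ there is no non-classical idempotent $\mathrm{QLS}(v)$. That is, every idempotent $\mathrm{QLS}(v)$ is equivalent to a square $(|L_{ij}\rangle)$ with $L$ a Latin square of order $v$. -/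

import Mathlib

namespace QLatin

/-- A `v × v` array whose entries are vectors of `ℂ^v` with its standard inner product. -/
abbrev QArray (v : ℕ) : Type := Fin v → Fin v → EuclideanSpace ℂ (Fin v)

/-- The family `f` of `v` vectors is an orthonormal basis of `ℂ^v`. -/
def IsONBasis {v : ℕ} (f : Fin v → EuclideanSpace ℂ (Fin v)) : Prop :=
  Orthonormal ℂ f ∧ Submodule.span ℂ (Set.range f) = ⊤

/-- Quantum Latin square of dimension `v`: every row and every column is an orthonormal basis. -/
def IsQLS {v : ℕ} (Φ : QArray v) : Prop :=
  (∀ i, IsONBasis (fun j => Φ i j)) ∧ (∀ j, IsONBasis (fun i => Φ i j))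

/-- Idempotent quantum Latin square: the diagonal entries form an orthonormal basis as well. -/
def IsIdempotentQLS {v : ℕ} (Φ : QArray v) : Prop :=
  IsQLS Φ ∧ IsONBasis (fun i => Φ i i)

/-- Equivalence of arrays: `Ψ i j = c i j • U (Φ (σ i) (τ j))` with `U` unitary, every `c i j` of
modulus one, and `σ`, `τ` permutations of the rows and of the columns. -/
def Equivalent {v : ℕ} (Φ Ψ : QArray v) : Prop :=
  ∃ (U : EuclideanSpace ℂ (Fin v) ≃ₗᵢ[ℂ] EuclideanSpace ℂ (Fin v))
    (c : Fin v → Fin v → ℂ) (σ τ : Equiv.Perm (Fin v)),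
    (∀ i j, ‖c i j‖ = 1) ∧ ∀ i j, Ψ i j = c i j • U (Φ (σ i) (τ j))

/-- Latin square of order `v`: each symbol occurs exactly once in each row and each column. -/
def IsLatinSquare {v : ℕ} (L : Fin v → Fin v → Fin v) : Prop :=
  (∀ i k, ∃! j, L i j = k) ∧ (∀ j k, ∃! i, L i j = k)

/-- The array obtained by replacing each symbol `l` by the computational basis vector `|l⟩`. -/
noncomputable def ofLatin {v : ℕ} (L : Fin v → Fin v → Fin v) : QArray v :=
  fun i j => EuclideanSpace.single (L i j) (1 : ℂ)

/-- Classical quantum Latin square: equivalent to one that comes from a Latin square. -/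
def IsClassicalQLS {v : ℕ} (Φ : QArray v) : Prop :=
  IsQLS Φ ∧ ∃ L : Fin v → Fin v → Fin v, IsLatinSquare L ∧ Equivalent (ofLatin L) Φ

/-- Non-classical quantum Latin square: a quantum Latin square that is not classical. -/
def IsNonClassicalQLS {v : ℕ} (Φ : QArray v) : Prop :=
  IsQLS Φ ∧ ¬ IsClassicalQLS Φ

end QLatin

open scoped ComplexConjugate

namespace QLatin

/-! Expand every entry in the orthonormal basis formed by the diagonal. For `i ≠ j` the entry at
`(i, j)` is orthogonal to the diagonal entries of its row and of its column, so at most `v - 2`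
coordinates survive. The point is that exactly one does (`unique_support`); each entry is then a
unimodular multiple of a diagonal vector, and the symbols form a Latin square.

For `v = 3` nothing remains to prove. For `v = 4` two entries of a row share at most one coordinate
outside the forced zeros, so orthogonality is the vanishing of one product. For `v = 5` they share
at most two, which gives `2 × 2` blocks with orthogonal rows and columns. Two nonzero coordinates
propagate through these blocks to the six off-diagonal cells on `{i, j, m}`. Norms then make the
third coordinate nonzero (`third_ne_zero`), and the orthogonality relations between `(i, j)` and
`(j, i)` on the three pairs of coordinates are incompatible. -/

/-- The coefficients of a square `Φ` with respect to its own diagonal, when that diagonal is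
an orthonormal basis: `a i j` lists the coordinates of `Φ i j`. -/
structure IsIdempotentTensor {v : ℕ} (a : Fin v → Fin v → Fin v → ℂ) : Prop where
  row : ∀ i j j', ∑ k, conj (a i j k) * a i j' k = if j = j' then 1 else 0
  row' : ∀ i k k', ∑ j, a i j k * conj (a i j k') = if k = k' then 1 else 0
  col : ∀ j i i', ∑ k, conj (a i j k) * a i' j k = if i = i' then 1 else 0
  col' : ∀ j k k', ∑ i, a i j k * conj (a i j k') = if k = k' then 1 else 0
  diag : ∀ i k, a i i k = if k = i then 1 else 0

namespace IsIdempotentTensor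

variable {v : ℕ} {a : Fin v → Fin v → Fin v → ℂ}

/-- Transposition exchanges the row and column relations, so every lemma on rows also serves for
columns. -/
theorem swap (h : IsIdempotentTensor a) : IsIdempotentTensor fun i j k => a j i k :=
  ⟨h.col, h.col', h.row, h.row', h.diag⟩

theorem apply_right (h : IsIdempotentTensor a) {i j : Fin v} (hij : i ≠ j) : a i j j = 0 := by
  have := h.col j j i
  simpa [h.diag, hij.symm] using this

theorem apply_left (h : IsIdempotentTensor a) {i j : Fin v} (hij : i ≠ j) : a i j i = 0 :=
  h.swap.apply_right hij.symm

theorem apply_diag_of_ne (h : IsIdempotentTensor a) {i k : Fin v} (hik : i ≠ k) : a i i k = 0 := by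
  simp [h.diag, hik.symm]

end IsIdempotentTensor

theorem sum_eq_list_sum {n : ℕ} {M : Type*} [AddCommMonoid M] {s : List (Fin n)} (hs : s.Nodup)
    (hn : s.length = n) (f : Fin n → M) : ∑ x, f x = (s.map f).sum := by
  rw [← List.sum_toFinset f hs, (Finset.card_eq_iff_eq_univ s.toFinset).1]
  rw [List.toFinset_card_of_nodup hs, hn, Fintype.card_fin]

theorem sum_fin_four_of_ne {M : Type*} [AddCommMonoid M] {i j k l : Fin 4}
    (h : [i, j, k, l].Nodup) (f : Fin 4 → M) :
    ∑ x, f x = f i + (f j + (f k + f l)) := by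
  simpa using sum_eq_list_sum h rfl f

theorem sum_fin_five_of_ne {M : Type*} [AddCommMonoid M] {i j k l m : Fin 5}
    (h : [i, j, k, l, m].Nodup) (f : Fin 5 → M) :
    ∑ x, f x = f i + (f j + (f k + (f l + f m))) := by
  simpa using sum_eq_list_sum h rfl f

/-- In a `2 × 2` block with orthogonal rows and orthogonal columns, a first row without zeros
determines the moduli of the second one. -/
theorem block_of_ne_zero {x y z w : ℂ} (hr : conj x * z + conj y * w = 0)
    (hc : x * conj y + z * conj w = 0) (hx : x ≠ 0) (hy : y ≠ 0) :
    z ≠ 0 ∧ w ≠ 0 ∧ Complex.normSq z = Complex.normSq y ∧ Complex.normSq w = Complex.normSq x := by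
  have hz : z ≠ 0 := by
    rintro rfl
    simp_all
  have hw : w ≠ 0 := by
    rintro rfl
    simp_all
  have h1 : Complex.normSq x * Complex.normSq z = Complex.normSq y * Complex.normSq w := by
    have := congrArg Complex.normSq (eq_neg_of_add_eq_zero_left hr)
    simpa [Complex.normSq_neg] using this
  have h2 : Complex.normSq x * Complex.normSq y = Complex.normSq z * Complex.normSq w := by
    have := congrArg Complex.normSq (eq_neg_of_add_eq_zero_left hc)
    simpa [Complex.normSq_neg] using this
  have px := Complex.normSq_pos.2 hx
  have py := Complex.normSq_pos.2 hy
  have pz := Complex.normSq_pos.2 hz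
  have pw := Complex.normSq_pos.2 hw
  have e : Complex.normSq z = Complex.normSq y := by
    have : Complex.normSq z ^ 2 = Complex.normSq y ^ 2 := by
      -- With `X, Y, Z, W` the squared moduli, `XZ = YW` and `XY = ZW` combine to `XW(Z² - Y²) = 0`.
      apply mul_left_cancel₀ (mul_pos px pw).ne'
      linear_combination
        Complex.normSq z * Complex.normSq w * h1 - Complex.normSq y * Complex.normSq w * h2
    exact (sq_eq_sq₀ pz.le py.le).1 this
  refine ⟨hz, hw, e, ?_⟩
  rw [e] at h2
  exact mul_left_cancel₀ py.ne' (by linarith)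

/-- The relation between consecutive `2 × 2` blocks is the one of an alternating chain. -/
theorem conj_mul_add_conj_mul_eq_zero_of_chain {x y z w s t p q : ℂ}
    (h₁ : conj x * z + conj y * w = 0) (h₂ : conj z * s + conj w * t = 0)
    (h₃ : conj s * p + conj t * q = 0) (hs : s ≠ 0) (hw : w ≠ 0) :
    conj x * p + conj y * q = 0 := by
  have h₂' : z * conj s + w * conj t = 0 := by
    simpa using congrArg conj h₂
  have hs' : conj s ≠ 0 := by simpa using hs
  apply mul_left_cancel₀ (mul_ne_zero hw hs')
  linear_combination w * conj x * h₃ + q * conj s * h₁ - q * conj x * h₂'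

/-! ### Supports of the entries in orders three, four and five. -/

namespace IsIdempotentTensor

theorem unique_support_three {a : Fin 3 → Fin 3 → Fin 3 → ℂ} (h : IsIdempotentTensor a)
    {i j k l : Fin 3} (hij : i ≠ j) (hkl : k ≠ l) : a i j k = 0 ∨ a i j l = 0 := by
  by_cases hki : k = i
  · exact .inl (by rw [hki]; exact h.apply_left hij)
  by_cases hkj : k = j
  · exact .inl (by rw [hkj]; exact h.apply_right hij)
  by_cases hli : l = i
  · exact .inr (by rw [hli]; exact h.apply_left hij)
  have : l = j := by lia
  exact .inr (by rw [this]; exact h.apply_right hij)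

/-- The forced zeros at `i`, `j` and `k` leave `l` as the only coordinate common to the two entries.
-/
theorem row_four {a : Fin 4 → Fin 4 → Fin 4 → ℂ} (h : IsIdempotentTensor a) {i j k l : Fin 4}
    (hd : [i, j, k, l].Nodup) : a i j l = 0 ∨ a i k l = 0 := by
  have e := h.row i j k
  simp only [List.nodup_cons, List.mem_cons, not_or] at hd
  rw [sum_fin_four_of_ne (i := i) (j := j) (k := k) (l := l) (by simp; tauto)] at e
  rw [h.apply_left (i := i) (j := j) (by tauto), h.apply_right (i := i) (j := j) (by tauto),
    h.apply_right (i := i) (j := k) (by tauto), if_neg (by tauto)] at e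
  simpa using e

theorem unique_support_four {a : Fin 4 → Fin 4 → Fin 4 → ℂ} (h : IsIdempotentTensor a)
    {i j k l : Fin 4} (hd : [i, j, k, l].Nodup) : a i j k = 0 ∨ a i j l = 0 := by
  have hd' := hd
  simp only [List.nodup_cons, List.mem_cons, not_or, List.not_mem_nil, not_false_eq_true,
    List.nodup_nil, and_true] at hd'
  obtain ⟨⟨hij, hik, hil⟩, ⟨hjk, hjl⟩, hkl⟩ := hd'
  by_contra! hne
  -- Entries `(i, k)` and `(i, l)` are left with coordinate `j` alone; being unit vectors, they
  -- cannot be orthogonal.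
  have e₁ : a i k l = 0 := (h.row_four hd).resolve_left hne.2
  have e₂ : a i l k = 0 :=
    (h.row_four (i := i) (j := j) (k := l) (l := k) (by simp; tauto)).resolve_left hne.1
  have e₃ := h.row_four (i := i) (j := k) (k := l) (l := j) (by simp; tauto)
  have n₁ := h.row i k k
  have n₂ := h.row i l l
  rw [sum_fin_four_of_ne hd, h.apply_left hik, h.apply_right hik, e₁] at n₁
  rw [sum_fin_four_of_ne hd, h.apply_left hil, h.apply_right hil, e₂] at n₂
  rcases e₃ with e | e
  · simp [e] at n₁
  · simp [e] at n₂

section Five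

variable {a : Fin 5 → Fin 5 → Fin 5 → ℂ}

theorem row_five (h : IsIdempotentTensor a) {i j m k l : Fin 5} (hd : [i, j, m, k, l].Nodup) :
    conj (a i j k) * a i m k + conj (a i j l) * a i m l = 0 := by
  have e := h.row i j m
  rw [sum_fin_five_of_ne hd] at e
  simp only [List.nodup_cons, List.mem_cons, not_or] at hd
  rw [h.apply_left (i := i) (j := j) (by tauto), h.apply_right (i := i) (j := j) (by tauto),
    h.apply_right (i := i) (j := m) (by tauto), if_neg (by tauto)] at e
  simpa using e

/-- This is orthogonality of coordinates `k` and `l` across row `i`: the cells in columns `i`, `k`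
and `l` contribute nothing, which leaves columns `j` and `m`. -/
theorem row_five' (h : IsIdempotentTensor a) {i j m k l : Fin 5} (hd : [i, j, m, k, l].Nodup) :
    a i j k * conj (a i j l) + a i m k * conj (a i m l) = 0 := by
  have e := h.row' i k l
  rw [sum_fin_five_of_ne hd] at e
  simp only [List.nodup_cons, List.mem_cons, not_or] at hd
  rw [h.apply_diag_of_ne (i := i) (k := k) (by tauto), h.apply_right (i := i) (j := k) (by tauto),
    h.apply_right (i := i) (j := l) (by tauto), if_neg (by tauto)] at e
  simpa using e

theorem row_block (h : IsIdempotentTensor a) {i j m k l : Fin 5} (hd : [i, j, m, k, l].Nodup)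
    (hk : a i j k ≠ 0) (hl : a i j l ≠ 0) :
    a i m k ≠ 0 ∧ a i m l ≠ 0 ∧ Complex.normSq (a i m k) = Complex.normSq (a i j l) ∧
      Complex.normSq (a i m l) = Complex.normSq (a i j k) :=
  block_of_ne_zero (h.row_five hd) (h.row_five' hd) hk hl

theorem normSq_row (h : IsIdempotentTensor a) {i j m k l : Fin 5} (hd : [i, j, m, k, l].Nodup) :
    Complex.normSq (a i j m) + Complex.normSq (a i j k) + Complex.normSq (a i j l) = 1 := by
  have e := h.row i j j
  rw [sum_fin_five_of_ne hd] at e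
  simp only [List.nodup_cons, List.mem_cons, not_or] at hd
  rw [h.apply_left (i := i) (j := j) (by tauto), h.apply_right (i := i) (j := j) (by tauto)] at e
  simp only [← Complex.normSq_eq_conj_mul_self] at e
  apply Complex.ofReal_injective
  simpa [add_assoc] using e

theorem normSq_row' (h : IsIdempotentTensor a) {i j m k l : Fin 5} (hd : [i, j, m, k, l].Nodup) :
    Complex.normSq (a i j k) + Complex.normSq (a i m k) + Complex.normSq (a i l k) = 1 := by
  have e := h.row' i k k
  rw [sum_fin_five_of_ne hd] at e
  simp only [List.nodup_cons, List.mem_cons, not_or] at hd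
  rw [h.apply_diag_of_ne (i := i) (k := k) (by tauto),
    h.apply_right (i := i) (j := k) (by tauto)] at e
  simp only [Complex.mul_conj] at e
  apply Complex.ofReal_injective
  simpa [add_assoc] using e

/-- If two coordinates of `a i j` are nonzero then so is the third one, and
`a j i` satisfies an orthogonality relation with `a i j` on these two coordinates. -/
theorem third_ne_zero (h : IsIdempotentTensor a) {i j m k l : Fin 5}
    (hd : [i, j, m, k, l].Nodup) (hk : a i j k ≠ 0) (hl : a i j l ≠ 0) :
    a i j m ≠ 0 ∧ a j i k ≠ 0 ∧ conj (a i j k) * a j i k + conj (a i j l) * a j i l = 0 := by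
  have hd' := hd
  simp only [List.nodup_cons, List.mem_cons, not_or, List.not_mem_nil, not_false_eq_true,
    List.nodup_nil, and_true] at hd'
  obtain ⟨⟨hij, him, hik, hil⟩, ⟨hjm, hjk, hjl⟩, ⟨hmk, hml⟩, hkl⟩ := hd'
  have d₁ : [m, i, j, k, l].Nodup := by simp; tauto
  have d₂ : [j, m, i, k, l].Nodup := by simp; tauto
  -- The walk `(i,j)`, `(i,m)`, `(j,m)`, `(j,i)`, `(m,i)`, `(m,j)` alternates row and column blocks;
  -- each step exchanges the two squared moduli.
  obtain ⟨imk, iml, eimk, eiml⟩ := h.row_block hd hk hl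
  obtain ⟨jmk, jml, ejmk, ejml⟩ := h.swap.row_block d₁ imk iml
  obtain ⟨jik, jil, ejik, ejil⟩ := h.row_block d₂ jmk jml
  obtain ⟨mik, mil, emik, emil⟩ := h.swap.row_block hd jik jil
  obtain ⟨mjk, mjl, emjk, emjl⟩ := h.row_block d₁ mik mil
  refine ⟨fun hm => ?_, jik, conj_mul_add_conj_mul_eq_zero_of_chain (h.row_five hd)
    (h.swap.row_five d₁) (h.row_five d₂) jmk iml⟩
  -- If `a i j m = 0`, the two squared moduli sum to `1`. In each of rows `i`, `j`, `m` they exhaust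
  -- coordinate `k`, so `a i l k`, `a j l k` and `a m l k` vanish, whereas column `l` requires their
  -- squared moduli to sum to `1`.
  have s₀ := h.normSq_row hd
  have s₁ := h.normSq_row' hd
  have s₂ := h.normSq_row' d₂
  have s₃ := h.normSq_row' d₁
  have s₄ := h.swap.normSq_row' (i := l) (j := i) (m := j) (k := k) (l := m) (by simp; tauto)
  simp only [hm, map_zero] at *
  linarith

theorem unique_support_five (h : IsIdempotentTensor a) {i j m k l : Fin 5}
    (hd : [i, j, m, k, l].Nodup) : a i j k = 0 ∨ a i j l = 0 := by
  have hd' := hd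
  simp only [List.nodup_cons, List.mem_cons, not_or, List.not_mem_nil, not_false_eq_true,
    List.nodup_nil, and_true] at hd'
  obtain ⟨⟨hij, him, hik, hil⟩, ⟨hjm, hjk, hjl⟩, ⟨hmk, hml⟩, hkl⟩ := hd'
  by_contra! hne
  obtain ⟨hm, hk', e₁⟩ := h.third_ne_zero hd hne.1 hne.2
  obtain ⟨-, -, e₂⟩ := h.third_ne_zero (i := i) (j := j) (m := k) (k := l) (l := m)
    (by simp; tauto) hne.2 hm
  obtain ⟨-, -, e₃⟩ := h.third_ne_zero (i := i) (j := j) (m := l) (k := m) (l := k)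
    (by simp; tauto) hm hne.1
  -- Three numbers whose pairwise sums all vanish are zero.
  have : conj (a i j k) * a j i k = 0 := by linear_combination (e₁ - e₂ + e₃) / 2
  simp [hne.1, hk'] at this

end Five

theorem unique_support {v : ℕ} (hv : v = 3 ∨ v = 4 ∨ v = 5) {a : Fin v → Fin v → Fin v → ℂ}
    (h : IsIdempotentTensor a) {i j k l : Fin v} (hkl : k ≠ l) : a i j k = 0 ∨ a i j l = 0 := by
  by_cases hij : i = j
  · subst hij
    by_cases hk : k = i
    · exact .inr (h.apply_diag_of_ne (hk ▸ hkl))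
    · exact .inl (h.apply_diag_of_ne (Ne.symm hk))
  by_cases hki : k = i
  · exact .inl (by rw [hki]; exact h.apply_left hij)
  by_cases hkj : k = j
  · exact .inl (by rw [hkj]; exact h.apply_right hij)
  by_cases hli : l = i
  · exact .inr (by rw [hli]; exact h.apply_left hij)
  by_cases hlj : l = j
  · exact .inr (by rw [hlj]; exact h.apply_right hij)
  rcases hv with rfl | rfl | rfl
  · exact h.unique_support_three hij hkl
  · exact h.unique_support_four (by simp; tauto)
  -- `m` is the fifth index, the remaining coordinate that may be nonzero.
  · obtain ⟨m, hm⟩ : ∃ m, m ∉ ({i, j, k, l} : Finset (Fin 5)) := by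
      by_contra! hall
      have h₁ := Finset.card_le_card (fun x _ => hall x : Finset.univ ⊆ _)
      have h₂ := Finset.card_le_four (a := i) (b := j) (c := k) (d := l)
      simp only [Finset.card_univ, Fintype.card_fin] at h₁
      omega
    simp only [Finset.mem_insert, Finset.mem_singleton, not_or] at hm
    exact h.unique_support_five (m := m) (by simp; tauto)

end IsIdempotentTensor

/-! ### From coordinates back to Latin squares. -/

theorem IsONBasis.exists_orthonormalBasis {v : ℕ} {f : Fin v → EuclideanSpace ℂ (Fin v)}
    (h : IsONBasis f) : ∃ b : OrthonormalBasis (Fin v) ℂ (EuclideanSpace ℂ (Fin v)), ⇑b = f :=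
  ⟨OrthonormalBasis.mk h.1 h.2.ge, OrthonormalBasis.coe_mk _ _⟩

theorem IsONBasis.sum_inner_mul_inner {v : ℕ} {f : Fin v → EuclideanSpace ℂ (Fin v)}
    (h : IsONBasis f) (x y : EuclideanSpace ℂ (Fin v)) :
    ∑ i, inner ℂ x (f i) * inner ℂ (f i) y = inner ℂ x y := by
  obtain ⟨b, rfl⟩ := h.exists_orthonormalBasis
  exact b.sum_inner_mul_inner x y

theorem IsONBasis.inner_eq_ite {v : ℕ} {f : Fin v → EuclideanSpace ℂ (Fin v)}
    (h : IsONBasis f) (i j : Fin v) : inner ℂ (f i) (f j) = if i = j then 1 else 0 :=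
  orthonormal_iff_ite.1 h.1 i j

/-- All but the last relation are Parseval's identity: in the diagonal basis for `row` and `col`, in
the basis given by a row or a column for `row'` and `col'`. -/
theorem IsIdempotentQLS.isIdempotentTensor {v : ℕ} {Φ : QArray v} (h : IsIdempotentQLS Φ) :
    IsIdempotentTensor fun i j k => inner ℂ (Φ k k) (Φ i j) := by
  obtain ⟨⟨hr, hc⟩, hd⟩ := h
  refine ⟨fun i j j' => ?_, fun i k k' => ?_, fun j i i' => ?_, fun j k k' => ?_, fun i k => ?_⟩
  · simpa only [inner_conj_symm, hd.sum_inner_mul_inner] using (hr i).inner_eq_ite j j'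
  · simpa only [inner_conj_symm, (hr i).sum_inner_mul_inner] using hd.inner_eq_ite k k'
  · simpa only [inner_conj_symm, hd.sum_inner_mul_inner] using (hc j).inner_eq_ite i i'
  · simpa only [inner_conj_symm, (hc j).sum_inner_mul_inner] using hd.inner_eq_ite k k'
  · exact hd.inner_eq_ite k i

/-- An array all of whose entries are unimodular multiples of the vectors of one orthonormal basis
comes from a Latin square as soon as it is a quantum Latin square. -/
theorem IsQLS.exists_isLatinSquare {v : ℕ} {Φ : QArray v} (h : IsQLS Φ)
    (b : OrthonormalBasis (Fin v) ℂ (EuclideanSpace ℂ (Fin v))) {L : Fin v → Fin v → Fin v}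
    {c : Fin v → Fin v → ℂ} (hΦ : ∀ i j, Φ i j = c i j • b (L i j)) :
    IsLatinSquare L ∧ Equivalent (ofLatin L) Φ := by
  have hc : ∀ i j, ‖c i j‖ = 1 := fun i j => by
    have := (h.1 i).1.1 j
    simpa [hΦ, norm_smul] using this
  have hc0 : ∀ i j, c i j ≠ 0 := fun i j => norm_ne_zero_iff.1 (by simp [hc])
  have inj {f : Fin v → EuclideanSpace ℂ (Fin v)} (hf : IsONBasis f) {d : Fin v → ℂ}
      (hd : ∀ x, d x ≠ 0) {M : Fin v → Fin v} (hM : ∀ x, f x = d x • b (M x)) :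
      Function.Bijective M := by
    -- A repeated symbol would make two vectors of an orthonormal family proportional.
    refine Finite.injective_iff_bijective.1 fun x y hxy => ?_
    by_contra hne
    have := hf.inner_eq_ite x y
    rw [if_neg hne, hM, hM, hxy] at this
    simp [hd] at this
  refine ⟨⟨fun i => (inj (h.1 i) (hc0 i) (hΦ i)).existsUnique,
    fun j => (inj (h.2 j) (fun i => hc0 i j) (fun i => hΦ i j)).existsUnique⟩,
    b.repr.symm, c, 1, 1, hc, fun i j => ?_⟩
  simp [ofLatin, hΦ i j]

theorem IsIdempotentQLS.exists_isLatinSquare {v : ℕ} (hv : v = 3 ∨ v = 4 ∨ v = 5) {Φ : QArray v}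
    (h : IsIdempotentQLS Φ) :
    ∃ L : Fin v → Fin v → Fin v, IsLatinSquare L ∧ Equivalent (ofLatin L) Φ := by
  obtain ⟨b, hb⟩ := h.2.exists_orthonormalBasis
  have hb' : ∀ k, b k = Φ k k := fun k => congrFun hb k
  have hex : ∀ i j, ∃ k, Φ i j = inner ℂ (Φ k k) (Φ i j) • b k := fun i j => by
    have hsum := b.sum_repr' (Φ i j)
    simp only [hb'] at hsum ⊢
    obtain ⟨k, hk⟩ : ∃ k, inner ℂ (Φ k k) (Φ i j) ≠ 0 := by
      by_contra! hall
      have := (h.1.1 i).1.ne_zero j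
      simp_all
    refine ⟨k, ?_⟩
    rw [Finset.sum_eq_single k (fun l _ hlk => ?_) (by simp)] at hsum
    · exact hsum.symm
    · rw [(h.isIdempotentTensor.unique_support hv (i := i) (j := j) hlk).resolve_right hk,
        zero_smul]
  choose L hL using hex
  exact ⟨L, h.1.exists_isLatinSquare b hL⟩

end QLatin

theorem theorem3p2 (v : ℕ) (hv : v = 3 ∨ v = 4 ∨ v = 5) :
    (¬ ∃ Φ : QLatin.QArray v, QLatin.IsIdempotentQLS Φ ∧ QLatin.IsNonClassicalQLS Φ) ∧
    (∀ Φ : QLatin.QArray v, QLatin.IsIdempotentQLS Φ →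
      ∃ L : Fin v → Fin v → Fin v,
        QLatin.IsLatinSquare L ∧ QLatin.Equivalent (QLatin.ofLatin L) Φ) :=
  ⟨fun ⟨_, hI, hQ, hn⟩ => hn ⟨hQ, hI.exists_isLatinSquare hv⟩,
    fun _ hI => hI.exists_isLatinSquare hv⟩
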